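/- Let $(\Omega,\mathcal F,\mathbb P)$ be a probability space, $\mathcal G\subset\mathcal F$ a sub-$\sigma$-algebra and $d\ge 0$ an integer. Let $h$ be the Hausdorff distance between nonempty compact subsets of $\mathbb R^d$ (with the Euclidean norm $|\cdot|$), and $\|A\|:=h(A,\{0\})=\sup_{a\in A}|a|$. For $\mathcal E\in\{\mathcal F,\mathcal G\}$, a set-valued map $F$ from $\Omega$ to the nonempty closed subsets of $\mathbb R^d$ is called $\mathcal E$-measurable if $\{F\cap B\ne\emptyset\}\in\mathcal E$ for every closed $B\subset\mathbb R^d$; $S^1_{\mathcal E}(F)$ denotes the set of $f\in L^1_{\mathcal E}(\Omega,\mathbb R^d)$ with $f\in F$ a.s.; and $\mathscr L^2_{\mathcal E}(\Omega,\mathscr K(\mathbb R^d))$ denotes the set of $\mathcal E$-measurable $F$ with nonempty compact convex values such that $\|F\|\le \ell$ a.s. for some nonnegative $\ell\in L^2_{\mathcal E}(\Omega,\mathbb R)$. The conditional expectation $\mathbb E[X|\mathcal G]$ of an $\mathcal F$-measurable $X$ is the (a.s. unique) $\mathcal G$-measurable set-valued map $Y$ with nonempty closed values and $S^1_{\mathcal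 G}(Y)\neq\emptyset$ such that $$S^1_{\mathcal G}(Y)=\mathrm{cl}_{L^1}\{\mathbb E[f|\mathcal G]: f\in S^1_{\mathcal F}(X)\}.$$ Let $X_1,X_2\in\mathscr L^2_{\mathcal F}(\Omega,\mathscr K(\mathbb R^d))$. Then $\mathbb E[X_1|\mathcal G]$ and $\mathbb E[X_2|\mathcal G]$ exist, are unique up to null sets and have versions in $\mathscr L^2_{\mathcal G}(\Omega,\mathscr K(\mathbb R^d))$; the random variables $h^2(X_1,X_2)$, $\|X_1\|^2$ and $h^2(\mathbb E[X_1|\mathcal G],\mathbb E[X_2|\mathcal G])$ are integrable; and $$h^2(\mathbb E[X_1|\mathcal G],\mathbb E[X_2|\mathcal G])\le \mathbb E[h^2(X_1,X_2)\,|\,\mathcal G]\quad \mathbb P\text{-a.s.}$$ In particular, with $\mathcal H_2(X_1,X_2):=(\mathbb E[h^2(X_1,X_2)])^{1/2}$, $$\mathcal H_2(\mathbb E[X_1|\mathcal G],\mathbb E[X_2|\mathcal G])\le \mathcal H_2(X_1,X_2),\qquad \|\mathbb E[X_1|\mathcal G]\|^2\le \mathbb E[\|X_1\|^2\,|\,\mathcal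 G]\quad \mathbb P\text{-a.s.}$$ -/

import Mathlib

open MeasureTheory
open scoped ENNReal

noncomputable section

variable {Ω E : Type*} [NormedAddCommGroup E]

/-- Measurability of a set-valued function with respect to the σ-algebra `m`:
`{ω | F ω ∩ B ≠ ∅} ∈ m` for every closed set `B`. -/
def SetValuedMeasurable (m : MeasurableSpace Ω) (F : Ω → Set E) : Prop :=
  ∀ B : Set E, IsClosed B → MeasurableSet[m] {ω | (F ω ∩ B).Nonempty}

/-- The norm of a nonempty compact set, `‖A‖ = h(A, {0})`, with `h` the Hausdorff distance. -/
def setNorm (A : Set E) : ℝ := Metric.hausdorffDist A {0}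

/-- The class `𝓛^p_m(Ω, 𝒦(E))`: measurable set-valued functions whose values are nonempty compact
convex sets and which are `p`-integrably bounded, that is, `‖F‖ ≤ ℓ` almost everywhere for some
`m`-measurable `ℓ ≥ 0` in `L^p`. -/
structure MemLpConvexCompact [NormedSpace ℝ E] (m : MeasurableSpace Ω) {m₀ : MeasurableSpace Ω}
    (p : ℝ≥0∞) (μ : Measure[m₀] Ω) (F : Ω → Set E) : Prop where
  measurable : SetValuedMeasurable m F
  nonempty : ∀ ω, (F ω).Nonempty
  isCompact : ∀ ω, IsCompact (F ω)
  convex : ∀ ω, Convex ℝ (F ω)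
  bounded : ∃ ℓ : Ω → ℝ, StronglyMeasurable[m] ℓ ∧ MemLp ℓ p μ ∧ (∀ ω, 0 ≤ ℓ ω) ∧
    ∀ᵐ ω ∂μ, setNorm (F ω) ≤ ℓ ω

/-- The set `S¹_m(F)` of integrable `m`-measurable selections of `F`, as a subset of `L¹(μ)`.
(`L¹` of the sub-σ-algebra `m` is the closed subspace of the classes in `L¹(μ)` that have an
`m`-measurable representative, so closures may be taken in `L¹(μ)`.) -/
def selectionsL1 (m : MeasurableSpace Ω) {m₀ : MeasurableSpace Ω} (μ : Measure[m₀] Ω)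
    (F : Ω → Set E) : Set (Lp E 1 μ) :=
  {f | AEStronglyMeasurable[m] (f : Ω → E) μ ∧ ∀ᵐ ω ∂μ, (f : Ω → E) ω ∈ F ω}

/-- `Y` is (a version of) the set-valued conditional expectation `𝔼[X | m]`: it is an
`m`-measurable set-valued function with nonempty closed values, it has an integrable `m`-measurable
selection, and `S¹_m(Y)` is the closure in `L¹` of `{𝔼[f | m] : f ∈ S¹(X)}`. -/
structure IsSetCondExp [NormedSpace ℝ E] (m : MeasurableSpace Ω) {m₀ : MeasurableSpace Ω}
    (μ : Measure[m₀] Ω) (X Y : Ω → Set E) : Prop where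
  measurable : SetValuedMeasurable m Y
  nonempty : ∀ ω, (Y ω).Nonempty
  isClosed : ∀ ω, IsClosed (Y ω)
  integrable : (selectionsL1 m μ Y).Nonempty
  selections_eq : selectionsL1 m μ Y =
    closure {g : Lp E 1 μ | ∃ f ∈ selectionsL1 m₀ μ X,
      (g : Ω → E) =ᵐ[μ] μ[(f : Ω → E) | m]}

/-- The distance `ℋ_p(X₁, X₂) = (𝔼[h^p(X₁, X₂)])^{1/p}`. -/
def setLpDist {m₀ : MeasurableSpace Ω} (p : ℝ) (μ : Measure[m₀] Ω) (X₁ X₂ : Ω → Set E) : ℝ :=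
  (∫ ω, Metric.hausdorffDist (X₁ ω) (X₂ ω) ^ p ∂μ) ^ (1 / p)

end

/-! A selection `φ` of `X₁` can be matched with a measurable selection `ψ` of `X₂` nearest to it, so
`‖φ - ψ‖ ≤ h(X₁, X₂)`. Conditioning gives `‖𝔼[φ|m] - 𝔼[ψ|m]‖ ≤ 𝔼[h(X₁, X₂)|m]`, and `𝔼[ψ|m]` is a
selection of `Y₂`. By symmetry `h(Y₁, Y₂) ≤ 𝔼[h(X₁, X₂)|m]`, and conditional Jensen for the square
finishes. The norm bound is the case `X₂ = {0}`.

To pass from selections to sets, `Y₁` must be the pointwise closure of countably many conditional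
expectations of selections, so that only countably many null sets occur. These conditional
expectations form a decomposable family (`MemLpConvexCompact.isDecomposable_condExpSelections`).
Such a family has a pointwise dense sequence (`IsDecomposable.exists_seq`), and pasting that
sequence recovers in `L¹` every integrable selection of its closure
(`IsDecomposable.exists_integral_norm_sub_lt`). This gives existence; uniqueness is
`ae_subset_of_selectionsL1_subset` used in both directions. Measurable selections come from
`exists_measurable_selection`. -/

section

open Metric Set TopologicalSpace Filter Topology

/-! ### Nearest points and distances to a dense sequence -/

section NearestPoints

variable {Ω E : Type*} [NormedAddCommGroup E]

/-- The points of `F ω` that are nearest to `f ω`. -/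
def nearestPoints (F : Ω → Set E) (f : Ω → E) (ω : Ω) : Set E :=
  F ω ∩ closedEBall (f ω) (infEDist (f ω) (F ω))

theorem nearestPoints_isCompact {F : Ω → Set E} {ω : Ω} (hc : IsCompact (F ω)) (f : Ω → E) :
    IsCompact (nearestPoints F f ω) :=
  hc.inter_right isClosed_closedEBall

theorem nearestPoints_nonempty {F : Ω → Set E} {ω : Ω} (hc : IsCompact (F ω))
    (hne : (F ω).Nonempty) (f : Ω → E) : (nearestPoints F f ω).Nonempty := by
  obtain ⟨y, hy, hxy⟩ := hc.exists_infEDist_eq_edist hne (f ω)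
  exact ⟨y, hy, by rw [mem_closedEBall, edist_comm, ← hxy]⟩

theorem edist_eq_of_mem_nearestPoints {F : Ω → Set E} {f : Ω → E} {ω : Ω} {y : E}
    (hy : y ∈ nearestPoints F f ω) : edist (f ω) y = infEDist (f ω) (F ω) :=
  le_antisymm (by simpa [edist_comm] using hy.2) (infEDist_le_edist_of_mem hy.1)

variable [SeparableSpace E]

/-- Successively minimise the distance to the points of a dense sequence. -/
noncomputable def successiveNearest (F : Ω → Set E) : ℕ → Ω → Set E
  | 0 => F
  | n + 1 => nearestPoints (successiveNearest F n) fun _ => denseSeq E n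

/-- The Hausdorff distance is the supremum of the difference of the two distance functions, and
these are continuous, so a dense sequence suffices. Measurability of `hausdorffDist` becomes a
countable condition. -/
theorem hausdorffDist_le_iff_denseSeq {A B : Set E} 
    (hfin : hausdorffEDist A B ≠ ∞) {r : ℝ} (hr : 0 ≤ r) :
    hausdorffDist A B ≤ r ↔
      ∀ n, |infDist (denseSeq E n) A - infDist (denseSeq E n) B| ≤ r := by
  constructor
  · intro h n
    have h1 := infDist_le_infDist_add_hausdorffDist (x := denseSeq E n) hfin
    have h2 := infDist_le_infDist_add_hausdorffDist (x := denseSeq E n)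
      (s := B) (t := A) (by rwa [hausdorffEDist_comm])
    rw [hausdorffDist_comm] at h2
    rw [abs_le]
    constructor <;> linarith
  · intro h
    have h' : ∀ x : E, |infDist x A - infDist x B| ≤ r := fun x =>
      (denseRange_denseSeq E).induction_on (p := fun x => |infDist x A - infDist x B| ≤ r) x
        (isClosed_le (((continuous_infDist_pt A).sub (continuous_infDist_pt B)).abs)
          continuous_const) h
    refine hausdorffDist_le_of_infDist hr (fun x hx => ?_) fun x hx => ?_
    · have := (abs_le.1 (h' x)).1
      rw [infDist_zero_of_mem hx] at this
      linarith
    · have := (abs_le.1 (h' x)).2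
      rw [infDist_zero_of_mem hx] at this
      linarith

end NearestPoints

/-! ### Measurability of set-valued maps and measurable selections -/

section SetValued

variable {Ω E : Type*} [MeasurableSpace Ω] [NormedAddCommGroup E]

theorem SetValuedMeasurable.inter_isClosed {F : Ω → Set E} (hF : SetValuedMeasurable ‹_› F)
    {B : Set E} (hB : IsClosed B) : SetValuedMeasurable ‹_› fun ω => F ω ∩ B := by
  intro C hC
  simpa only [inter_assoc] using hF (B ∩ C) (hB.inter hC)

theorem SetValuedMeasurable.ite {F G : Ω → Set E} (hF : SetValuedMeasurable ‹_› F)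
    (hG : SetValuedMeasurable ‹_› G) {A : Set Ω} (hA : MeasurableSet A) [DecidablePred (· ∈ A)] :
    SetValuedMeasurable ‹_› (A.piecewise F G) := by
  intro B hB
  convert! (hA.inter (hF B hB)).union (hA.compl.inter (hG B hB)) using 1
  ext ω
  by_cases h : ω ∈ A <;> simp [h]

theorem setValuedMeasurable_singleton [MeasurableSpace E] [BorelSpace E] {f : Ω → E}
    (hf : Measurable f) : SetValuedMeasurable ‹_› fun ω => ({f ω} : Set E) := by
  intro B hB
  simp only [singleton_inter_nonempty]
  exact hf hB.measurableSet

/-- By compactness the distance is attained, so it is at most `r < ∞` exactly when `F ω` meets the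
closed ball of radius `r`. Empty values are allowed because the result is applied to `F ∩ B`. -/
theorem SetValuedMeasurable.measurable_infEDist_const {F : Ω → Set E}
    (hF : SetValuedMeasurable ‹_› F) (hc : ∀ ω, IsCompact (F ω)) (x : E) :
    Measurable fun ω => infEDist x (F ω) := by
  refine measurable_of_Iic fun r => ?_
  obtain rfl | hr := eq_or_ne r ∞
  · simp
  convert! hF (closedEBall x r) isClosed_closedEBall using 1
  ext ω
  simp only [mem_preimage, mem_Iic, mem_ofPred_eq]
  constructor
  · intro h
    rcases (F ω).eq_empty_or_nonempty with he | hne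
    · rw [he, infEDist_empty, top_le_iff] at h
      exact absurd h hr
    · obtain ⟨y, hy, hxy⟩ := (hc ω).exists_infEDist_eq_edist hne x
      exact ⟨y, hy, by rwa [mem_closedEBall, edist_comm, ← hxy]⟩
  · rintro ⟨y, hy, hyr⟩
    rw [mem_closedEBall, edist_comm] at hyr
    exact (infEDist_le_edist_of_mem hy).trans hyr

variable [SecondCountableTopology E]

theorem SetValuedMeasurable.measurable_hausdorffDist {F G : Ω → Set E}
    (hF : SetValuedMeasurable ‹_› F) (hG : SetValuedMeasurable ‹_› G)
    (hFc : ∀ ω, IsCompact (F ω)) (hGc : ∀ ω, IsCompact (G ω))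
    (hFn : ∀ ω, (F ω).Nonempty) (hGn : ∀ ω, (G ω).Nonempty) :
    Measurable fun ω => hausdorffDist (F ω) (G ω) := by
  refine measurable_of_Iic fun r => ?_
  rcases lt_or_ge r 0 with hr | hr
  · convert! MeasurableSet.empty using 1
    ext ω
    simpa using hr.trans_le hausdorffDist_nonneg
  · have : (fun ω => hausdorffDist (F ω) (G ω)) ⁻¹' Iic r =
        ⋂ n, {ω | |infDist (denseSeq E n) (F ω) - infDist (denseSeq E n) (G ω)| ≤ r} := by
      ext ω
      simp only [mem_preimage, mem_Iic, mem_iInter, mem_ofPred_eq]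
      exact hausdorffDist_le_iff_denseSeq 
        (hausdorffEDist_ne_top_of_nonempty_of_bounded (hFn ω) (hGn ω) (hFc ω).isBounded
          (hGc ω).isBounded) hr
    rw [this]
    refine .iInter fun n => measurableSet_le ?_ measurable_const
    exact ((hF.measurable_infEDist_const hFc _).ennreal_toReal.sub
      (hG.measurable_infEDist_const hGc _).ennreal_toReal).abs

variable [MeasurableSpace E] [BorelSpace E]

theorem SetValuedMeasurable.measurable_infEDist {F : Ω → Set E}
    (hF : SetValuedMeasurable ‹_› F) (hc : ∀ ω, IsCompact (F ω)) {f : Ω → E} (hf : Measurable f) :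
    Measurable fun ω => infEDist (f ω) (F ω) := by
  -- The distance function is 1-Lipschitz, so a countable infimum over dense centres computes it at
  -- the moving point `f ω`.
  have key : (fun ω => infEDist (f ω) (F ω)) =
      fun ω => ⨅ i : ℕ, (edist (f ω) (denseSeq E i) + infEDist (denseSeq E i) (F ω)) := by
    funext ω
    refine le_antisymm (le_iInf fun i => infEDist_le_edist_add_infEDist) ?_
    refine ENNReal.le_of_forall_pos_le_add fun ε hε _ => ?_
    obtain ⟨i, hi⟩ := (denseRange_denseSeq E).exists_dist_lt (f ω) (half_pos (NNReal.coe_pos.2 hε))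
    replace hi : edist (f ω) (denseSeq E i) ≤ ε / 2 := by
      rw [edist_dist]
      refine (ENNReal.ofReal_le_ofReal hi.le).trans_eq ?_
      rw [ENNReal.ofReal_div_of_pos two_pos]
      simp
    calc _ ≤ edist (f ω) (denseSeq E i) + infEDist (denseSeq E i) (F ω) := iInf_le _ i
      _ ≤ edist (f ω) (denseSeq E i) + (edist (denseSeq E i) (f ω) + infEDist (f ω) (F ω)) := by
        gcongr; exact infEDist_le_edist_add_infEDist
      _ ≤ ε / 2 + (ε / 2 + infEDist (f ω) (F ω)) := by
        gcongr
        rwa [edist_comm]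
      _ = infEDist (f ω) (F ω) + ε := by rw [← add_assoc, ENNReal.add_halves, add_comm]
  rw [key]
  exact .iInf fun i => (hf.edist measurable_const).add (hF.measurable_infEDist_const hc _)

/-- A nearest point lies in `B` exactly when `F ω ∩ B` is no farther from `f ω` than `F ω` is. If `F
ω ∩ B` is empty its distance is `∞`, and the inequality fails. -/
theorem SetValuedMeasurable.nearestPoints {F : Ω → Set E} (hF : SetValuedMeasurable ‹_› F)
    (hc : ∀ ω, IsCompact (F ω)) (hne : ∀ ω, (F ω).Nonempty) {f : Ω → E} (hf : Measurable f) :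
    SetValuedMeasurable ‹_› (nearestPoints F f) := by
  intro B hB
  convert! measurableSet_le
    ((hF.inter_isClosed hB).measurable_infEDist (fun ω => (hc ω).inter_right hB) hf)
    (hF.measurable_infEDist hc hf) using 1
  ext ω
  simp only [mem_ofPred_eq, _root_.nearestPoints]
  constructor
  · rintro ⟨y, ⟨hy, hyr⟩, hyB⟩
    rw [mem_closedEBall, edist_comm] at hyr
    exact (infEDist_le_edist_of_mem (mem_inter hy hyB)).trans hyr
  · intro h
    have hn : (F ω ∩ B).Nonempty := by
      rw [nonempty_iff_ne_empty]
      intro he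
      rw [he, infEDist_empty, top_le_iff] at h
      exact infEDist_ne_top (hne ω) h
    obtain ⟨y, hy, hxy⟩ := ((hc ω).inter_right hB).exists_infEDist_eq_edist hn (f ω)
    exact ⟨y, ⟨hy.1, by rwa [mem_closedEBall, edist_comm, ← hxy]⟩, hy.2⟩

/-- Minimising successively the distance to each dense point yields decreasing nonempty compact
sets. Points of their intersection have equal distances to a dense set, so there is exactly one. By
compactness it lies in a closed `B` if and only if every set of the sequence meets `B`. -/
theorem exists_measurable_selection {F : Ω → Set E} (hF : SetValuedMeasurable ‹_› F)
    (hc : ∀ ω, IsCompact (F ω)) (hne : ∀ ω, (F ω).Nonempty) :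
    ∃ f : Ω → E, Measurable f ∧ ∀ ω, f ω ∈ F ω := by
  have hK : ∀ n, SetValuedMeasurable ‹_› (successiveNearest F n) ∧
      (∀ ω, IsCompact (successiveNearest F n ω)) ∧ ∀ ω, (successiveNearest F n ω).Nonempty := by
    intro n
    induction n with
    | zero => exact ⟨hF, hc, hne⟩
    | succ n ih =>
      exact ⟨ih.1.nearestPoints ih.2.1 ih.2.2 measurable_const,
        fun ω => nearestPoints_isCompact (ih.2.1 ω) _,
        fun ω => nearestPoints_nonempty (ih.2.1 ω) (ih.2.2 ω) _⟩
  have hanti : ∀ n ω, successiveNearest F (n + 1) ω ⊆ successiveNearest F n ω :=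
    fun n ω => inter_subset_left
  have hint : ∀ (B : Set E), IsClosed B → ∀ ω, (∀ n, (successiveNearest F n ω ∩ B).Nonempty) →
      (⋂ n, successiveNearest F n ω ∩ B).Nonempty := fun B hB ω h =>
    IsCompact.nonempty_iInter_of_sequence_nonempty_isCompact_isClosed _
      (fun n => inter_subset_inter_left _ (hanti n ω)) h (((hK 0).2.1 ω).inter_right hB)
      fun n => ((hK n).2.1 ω).isClosed.inter hB
  have huniq : ∀ ω y z, (∀ n, y ∈ successiveNearest F n ω) →
      (∀ n, z ∈ successiveNearest F n ω) → y = z := by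
    intro ω y z hy hz
    have h : ∀ n, edist (denseSeq E n) y = edist (denseSeq E n) z := fun n =>
      (edist_eq_of_mem_nearestPoints (hy (n + 1))).trans
        (edist_eq_of_mem_nearestPoints (hz (n + 1))).symm
    have h2 : (fun x => edist x y) = fun x => edist x z :=
      (denseRange_denseSeq E).equalizer (by fun_prop) (by fun_prop) (funext h)
    have := congrFun h2 y
    simpa [eq_comm] using this
  have hex : ∀ ω, ∃ y, ∀ n, y ∈ successiveNearest F n ω := by
    intro ω
    obtain ⟨y, hy⟩ := hint univ isClosed_univ ω fun n => by simpa using (hK n).2.2 ω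
    exact ⟨y, by simpa using hy⟩
  choose f hf using hex
  refine ⟨f, measurable_of_isClosed fun B hB => ?_, fun ω => hf ω 0⟩
  convert! MeasurableSet.iInter fun n => (hK n).1 B hB using 1
  ext ω
  simp only [mem_preimage, mem_iInter, mem_ofPred_eq]
  refine ⟨fun h n => ⟨f ω, hf ω n, h⟩, fun h => ?_⟩
  obtain ⟨y, hy⟩ := hint B hB ω h
  rw [mem_iInter] at hy
  rw [huniq ω (f ω) y (hf ω) fun n => (hy n).1]
  exact (hy 0).2

end SetValued

/-! ### Decomposable families of integrable functions -/

section Decomposable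

variable {Ω E : Type*} [NormedAddCommGroup E]

/-- A nonempty family of integrable `m`-measurable functions that is stable under pasting along
`m`-measurable sets. -/
structure IsDecomposable (m : MeasurableSpace Ω) {m₀ : MeasurableSpace Ω} (μ : Measure[m₀] Ω)
    (M : Set (Ω → E)) : Prop where
  nonempty : M.Nonempty
  stronglyMeasurable : ∀ f ∈ M, StronglyMeasurable[m] f
  integrable : ∀ f ∈ M, Integrable f μ
  paste : ∀ f ∈ M, ∀ g ∈ M, ∀ A, MeasurableSet[m] A → A.indicator f + Aᶜ.indicator g ∈ M

variable {m m₀ : MeasurableSpace Ω} {μ : Measure[m₀] Ω} {M : Set (Ω → E)}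

/-- A sequence of elements of a decomposable family that minimises the `L¹`-distance to a constant
comes almost everywhere as near to this constant as any element of the family. -/
theorem IsDecomposable.ae_exists_lt_of_minimizing [IsFiniteMeasure μ]
    (hM : IsDecomposable m μ M) (hm : m ≤ m₀) {x : E} {f : ℕ → Ω → E} (hf : ∀ n, f n ∈ M)
    (hmin : ∀ n, ∀ g ∈ M, ∫ ω, ‖f n ω - x‖ ∂μ ≤ ∫ ω, ‖g ω - x‖ ∂μ + 1 / (n + 1))
    {g : Ω → E} (hg : g ∈ M) {ε : ℝ} (hε : 0 < ε) :
    ∀ᵐ ω ∂μ, ∃ n, ‖f n ω - x‖ < ‖g ω - x‖ + ε := by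
  -- On `A` every `f n` is worse than `g` by at least `ε`. Replacing `f n` by `g` on `A` lowers the
  -- integral by at least `ε * μ.real A`, while near-minimality leaves room for only `1 / (n + 1)`.
  set A : Set Ω := ⋂ n, {ω | ‖g ω - x‖ + ε ≤ ‖f n ω - x‖} with hA
  have hAm : MeasurableSet[m] A := by
    refine .iInter fun n => ?_
    exact StronglyMeasurable.measurableSet_le
      (((hM.stronglyMeasurable g hg).sub stronglyMeasurable_const).norm.add
        stronglyMeasurable_const)
      ((hM.stronglyMeasurable _ (hf n)).sub stronglyMeasurable_const).norm
  have hint : ∀ u ∈ M, Integrable (fun ω => ‖u ω - x‖) μ := fun u hu =>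
    ((hM.integrable u hu).sub (integrable_const x)).norm
  have hle : ∀ n : ℕ, ε * μ.real A ≤ 1 / ((n : ℝ) + 1) := by
    intro n
    have hu := hM.paste g hg (f n) (hf n) A hAm
    have h1 := hmin n _ hu
    have h2 : ∫ ω, ‖(A.indicator g + Aᶜ.indicator (f n)) ω - x‖ + A.indicator (fun _ => ε) ω ∂μ ≤
        ∫ ω, ‖f n ω - x‖ ∂μ := by
      refine integral_mono ((hint _ hu).add ((integrable_const ε).indicator (hm _ hAm)))
        (hint _ (hf n)) fun ω => ?_
      by_cases hω : ω ∈ A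
      · simpa [hω] using mem_iInter.1 hω n
      · simp [hω]
    rw [integral_add (hint _ hu) ((integrable_const ε).indicator (hm _ hAm)),
      integral_indicator_const _ (hm _ hAm), smul_eq_mul, mul_comm] at h2
    linarith
  have h0 : ε * μ.real A ≤ 0 :=
    ge_of_tendsto' tendsto_one_div_add_atTop_nhds_zero_nat hle
  have h1 : μ.real A = 0 := le_antisymm (by
    by_contra! h
    exact absurd h0 (mul_pos hε h).not_ge) measureReal_nonneg
  have h2 : μ A = 0 := (measureReal_eq_zero_iff).1 h1
  filter_upwards [measure_eq_zero_iff_ae_notMem.1 h2] with ω hω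
  simpa [hA] using hω

theorem IsDecomposable.exists_minimizing (hM : IsDecomposable m μ M) (x : E) :
    ∃ f : ℕ → Ω → E, (∀ n, f n ∈ M) ∧
      ∀ n : ℕ, ∀ g ∈ M, ∫ ω, ‖f n ω - x‖ ∂μ ≤ ∫ ω, ‖g ω - x‖ ∂μ + 1 / (n + 1) := by
  set S : Set ℝ := (fun g : Ω → E => ∫ ω, ‖g ω - x‖ ∂μ) '' M
  have hS : S.Nonempty := hM.nonempty.image _
  have hb : BddBelow S := ⟨0, by
    rintro _ ⟨g, -, rfl⟩
    exact integral_nonneg fun ω => norm_nonneg _⟩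
  have : ∀ n : ℕ, ∃ f ∈ M, ∫ ω, ‖f ω - x‖ ∂μ < sInf S + 1 / (n + 1) := by
    intro n
    obtain ⟨_, ⟨f, hf, rfl⟩, h⟩ := exists_lt_of_csInf_lt hS
      (lt_add_of_pos_right (sInf S) (Nat.one_div_pos_of_nat (n := n)))
    exact ⟨f, hf, h⟩
  choose f hf h using this
  refine ⟨f, hf, fun n g hg => (h n).le.trans ?_⟩
  gcongr
  exact csInf_le hb ⟨g, hg, rfl⟩

/-- A decomposable family has a countable subfamily whose pointwise closure contains almost
everywhere every member of the family. -/
theorem IsDecomposable.exists_seq [SeparableSpace E] [IsFiniteMeasure μ]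
    (hM : IsDecomposable m μ M) (hm : m ≤ m₀) :
    ∃ f : ℕ → Ω → E, (∀ n, f n ∈ M) ∧
      ∀ g ∈ M, ∀ᵐ ω ∂μ, g ω ∈ closure (range fun n => f n ω) := by
  choose F hF hmin using fun i : ℕ => hM.exists_minimizing (denseSeq E i)
  -- The pairing enumerates the minimising sequences of all dense points. For a dense point close to
  -- `g ω`, a member nearly as close to it as `g ω` is must be close to `g ω`.
  refine ⟨fun n => F n.unpair.1 n.unpair.2, fun n => hF _ _, fun g hg => ?_⟩
  have : ∀ᵐ ω ∂μ, ∀ i k : ℕ, ∃ n,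
      ‖F i n ω - denseSeq E i‖ < ‖g ω - denseSeq E i‖ + 1 / ((k : ℝ) + 1) := by
    refine ae_all_iff.2 fun i => ae_all_iff.2 fun k => ?_
    exact hM.ae_exists_lt_of_minimizing hm (hF i) (hmin i) hg Nat.one_div_pos_of_nat
  filter_upwards [this] with ω hω
  rw [Metric.mem_closure_range_iff]
  intro ε hε
  obtain ⟨i, hi⟩ := (denseRange_denseSeq E).exists_dist_lt (g ω) (ε := ε / 3) (by positivity)
  obtain ⟨k, hk⟩ := exists_nat_one_div_lt (K := ℝ) (show 0 < ε / 3 by positivity)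
  obtain ⟨n, hn⟩ := hω i k
  refine ⟨Nat.pair i n, ?_⟩
  simp only [Nat.unpair_pair]
  rw [← dist_eq_norm, ← dist_eq_norm] at hn
  have := dist_triangle_right (g ω) (F i n ω) (denseSeq E i)
  linarith

/-- Paste the functions `f n` along the sets `A n`, starting from `f 0`. -/
noncomputable def pasteSeq (f : ℕ → Ω → E) (A : ℕ → Set Ω) : ℕ → Ω → E
  | 0 => f 0
  | n + 1 => (A n).indicator (f n) + (A n)ᶜ.indicator (pasteSeq f A n)

/-- Every integrable function with values in the pointwise closure of a sequence in a decomposable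
family is an `L¹`-limit of elements of the family. -/
theorem IsDecomposable.exists_integral_norm_sub_lt [IsProbabilityMeasure μ]
    (hM : IsDecomposable m μ M) (hm : m ≤ m₀) {f : ℕ → Ω → E} (hf : ∀ n, f n ∈ M)
    {g : Ω → E} (hgm : StronglyMeasurable[m] g) (hgi : Integrable g μ)
    (hg : ∀ᵐ ω ∂μ, g ω ∈ closure (range fun n => f n ω)) {ε : ℝ} (hε : 0 < ε) :
    ∃ u ∈ M, ∫ ω, ‖g ω - u ω‖ ∂μ < ε := by
  set A : ℕ → Set Ω := fun n => {ω | ‖g ω - f n ω‖ < ε / 2}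
  have hA : ∀ n, MeasurableSet[m] (A n) := fun n =>
    StronglyMeasurable.measurableSet_lt (hgm.sub (hM.stronglyMeasurable _ (hf n))).norm
      stronglyMeasurable_const
  have hu : ∀ n, pasteSeq f A n ∈ M := by
    intro n
    induction n with
    | zero => exact hf 0
    | succ n ih => exact hM.paste _ (hf n) _ ih _ (hA n)
  set R : ℕ → Set Ω := fun n => ⋂ k ∈ Finset.range n, (A k)ᶜ
  have hR : ∀ n, MeasurableSet[m] (R n) := fun n =>
    Finset.measurableSet_biInter _ fun k _ => (hA k).compl
  -- Off `R n` some `A k` with `k < n` contains `ω`, and the last such `k` gives the pasted value;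
  -- on `R n` the default `f 0` remains. Almost every `ω` eventually leaves `R n`, so dominated
  -- convergence removes the second term.
  have hbound : ∀ n ω, ‖g ω - pasteSeq f A n ω‖ ≤
      ε / 2 + (R n).indicator (fun ω => ‖g ω - f 0 ω‖) ω := by
    intro n ω
    induction n with
    | zero => simpa [R, pasteSeq] using (half_pos hε).le
    | succ n ih =>
      by_cases hω : ω ∈ A n
      · have h1 : ‖g ω - f n ω‖ < ε / 2 := hω
        have h2 : 0 ≤ (R (n + 1)).indicator (fun ω => ‖g ω - f 0 ω‖) ω :=
          indicator_nonneg (fun _ _ => norm_nonneg _) _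
        simp only [pasteSeq, Pi.add_apply, indicator_of_mem hω,
          indicator_of_notMem (notMem_compl_iff.2 hω), add_zero]
        linarith
      · have h1 : (R (n + 1)).indicator (fun ω => ‖g ω - f 0 ω‖) ω =
            (R n).indicator (fun ω => ‖g ω - f 0 ω‖) ω := by
          have : ω ∈ R (n + 1) ↔ ω ∈ R n := by
            simp only [R, Finset.mem_range, mem_iInter, Nat.lt_succ_iff_lt_or_eq]
            refine ⟨fun h k hk => h k (Or.inl hk), ?_⟩
            rintro h k (hk | rfl)
            exacts [h k hk, hω]
          by_cases h : ω ∈ R n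
          · rw [indicator_of_mem h, indicator_of_mem (this.2 h)]
          · rw [indicator_of_notMem h, indicator_of_notMem (this.not.2 h)]
        rw [h1]
        simpa only [pasteSeq, Pi.add_apply, indicator_of_notMem hω,
          indicator_of_mem (mem_compl hω), zero_add] using ih
  have hgf : Integrable (fun ω => ‖g ω - f 0 ω‖) μ :=
    (hgi.sub (hM.integrable _ (hf 0))).norm
  have hlim : Tendsto (fun n => ∫ ω, (R n).indicator (fun ω => ‖g ω - f 0 ω‖) ω ∂μ) atTop
      (𝓝 (∫ _, (0 : ℝ) ∂μ)) := by
    refine tendsto_integral_of_dominated_convergence (fun ω => ‖g ω - f 0 ω‖)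
      (fun n => (hgf.indicator (hm _ (hR n))).aestronglyMeasurable) hgf
      (fun n => .of_forall fun ω => ?_) ?_
    · rw [Real.norm_of_nonneg (indicator_nonneg (fun _ _ => norm_nonneg _) _)]
      exact indicator_le_self' (fun _ _ => norm_nonneg _) _
    · filter_upwards [hg] with ω hω
      obtain ⟨k, hk⟩ := Metric.mem_closure_range_iff.1 hω (ε / 2) (by positivity)
      refine tendsto_const_nhds.congr' ?_
      filter_upwards [eventually_gt_atTop k] with n hn
      rw [indicator_of_notMem]
      simp only [R, Finset.mem_range, mem_iInter, not_forall]
      refine ⟨k, hn, notMem_compl_iff.2 ?_⟩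
      rwa [dist_eq_norm] at hk
  rw [integral_zero] at hlim
  obtain ⟨n, hn⟩ := (hlim.eventually (gt_mem_nhds (half_pos hε))).exists
  refine ⟨pasteSeq f A n, hu n, ?_⟩
  calc ∫ ω, ‖g ω - pasteSeq f A n ω‖ ∂μ
      ≤ ∫ ω, ε / 2 + (R n).indicator (fun ω => ‖g ω - f 0 ω‖) ω ∂μ :=
        integral_mono (hgi.sub (hM.integrable _ (hu n))).norm
          ((integrable_const _).add (hgf.indicator (hm _ (hR n)))) (hbound n)
    _ = ε / 2 + ∫ ω, (R n).indicator (fun ω => ‖g ω - f 0 ω‖) ω ∂μ := by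
        rw [integral_add (integrable_const _) (hgf.indicator (hm _ (hR n)))]
        simp
    _ < ε := by linarith

end Decomposable

/-! ### Pointwise closures of sequences of functions -/

section ClosureRange

variable {Ω E : Type*} [MeasurableSpace Ω] [NormedAddCommGroup E]

theorem measurableSet_mem_closure_range {f : ℕ → Ω → E} (hf : ∀ n, StronglyMeasurable (f n))
    {g : Ω → E} (hg : StronglyMeasurable g) :
    MeasurableSet {ω | g ω ∈ closure (range fun n => f n ω)} := by
  have : {ω | g ω ∈ closure (range fun n => f n ω)} =
      ⋂ k : ℕ, ⋃ n, {ω | dist (g ω) (f n ω) < 1 / ((k : ℝ) + 1)} := by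
    ext ω
    simp only [mem_ofPred_eq, mem_iInter, mem_iUnion, Metric.mem_closure_range_iff]
    refine ⟨fun h k => h _ Nat.one_div_pos_of_nat, fun h ε hε => ?_⟩
    obtain ⟨k, hk⟩ := exists_nat_one_div_lt hε
    obtain ⟨n, hn⟩ := h k
    exact ⟨n, hn.trans hk⟩
  rw [this]
  exact .iInter fun k => .iUnion fun n =>
    (hg.dist (hf n)).measurableSet_lt stronglyMeasurable_const

/-- The closure meets `B` exactly when the infimum over `n` of the distances from `f n ω` to `B` is
zero; compactness turns a vanishing infimum into a common point. -/
theorem setValuedMeasurable_closure_range [MeasurableSpace E] [BorelSpace E]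
    {f : ℕ → Ω → E} (hf : ∀ n, Measurable (f n))
    (hc : ∀ ω, IsCompact (closure (range fun n => f n ω))) :
    SetValuedMeasurable ‹_› fun ω => closure (range fun n => f n ω) := by
  intro B hB
  have : {ω | (closure (range fun n => f n ω) ∩ B).Nonempty} =
      (fun ω => ⨅ n, infEDist (f n ω) B) ⁻¹' {0} := by
    ext ω
    simp only [mem_ofPred_eq, mem_preimage, mem_singleton_iff]
    constructor
    · rintro ⟨y, hy, hyB⟩
      refine le_antisymm (ENNReal.le_of_forall_pos_le_add fun ε hε _ => ?_) zero_le
      obtain ⟨n, hn⟩ := Metric.mem_closure_range_iff.1 hy ε (NNReal.coe_pos.2 hε)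
      refine (iInf_le _ n).trans ((infEDist_le_edist_of_mem hyB).trans ?_)
      rw [zero_add, edist_comm, edist_dist]
      exact (ENNReal.ofReal_le_ofReal hn.le).trans_eq ENNReal.ofReal_coe_nnreal
    · intro h
      obtain ⟨y, hy, hmin⟩ := (hc ω).exists_isMinOn ((range_nonempty _).closure)
        (continuous_infEDist (s := B)).continuousOn
      refine ⟨y, hy, ?_⟩
      rw [mem_iff_infEDist_zero_of_closed hB, ← nonpos_iff_eq_zero, ← h]
      exact le_iInf fun n => isMinOn_iff.1 hmin _ (subset_closure (mem_range_self n))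
  rw [this]
  exact (Measurable.iInf fun n => (hf n).infEDist) (measurableSet_singleton 0)

theorem convex_closure_range_of_rat [NormedSpace ℝ E] {v : ℕ → E}
    (h : ∀ (j k : ℕ) (q : ℚ), 0 ≤ q → q ≤ 1 →
      (1 - (q : ℝ)) • v j + (q : ℝ) • v k ∈ closure (range v)) :
    Convex ℝ (closure (range v)) := by
  -- Clamping to `[0, 1]` makes the claim meaningful for all real `t`, so that density of `ℚ` in `ℝ`
  -- applies.
  set c : ℝ → ℝ := fun t => max 0 (min 1 t) with hc
  have hcc : Continuous c := by fun_prop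
  have h1 : ∀ (j k : ℕ) (t : ℝ), (1 - c t) • v j + c t • v k ∈ closure (range v) := by
    intro j k t
    refine (Rat.denseRange_cast (𝕜 := ℝ)).induction_on
      (p := fun t => (1 - c t) • v j + c t • v k ∈ closure (range v)) t
      (isClosed_closure.preimage (by fun_prop)) fun q => ?_
    have := h j k (max 0 (min 1 q)) (le_max_left _ _) (max_le zero_le_one (min_le_left _ _))
    simpa [hc] using this
  rw [convex_iff_segment_subset]
  have h2 : ∀ t ∈ Icc (0 : ℝ) 1, ∀ x ∈ closure (range v), ∀ y ∈ closure (range v),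
      (1 - t) • x + t • y ∈ closure (range v) := by
    intro t ht x hx y hy
    rw [← closure_closure (s := range v)]
    refine map_mem_closure₂ (f := fun x y => (1 - t) • x + t • y) (by fun_prop) hx hy ?_
    rintro _ ⟨j, rfl⟩ _ ⟨k, rfl⟩
    have := h1 j k t
    rwa [show c t = t by simp [hc, ht.1, ht.2]] at this
  intro x hx y hy z hz
  rw [segment_eq_image] at hz
  obtain ⟨t, ht, rfl⟩ := hz
  exact h2 t ht x hx y hy

end ClosureRange

/-! ### The norm of a compact set -/

section SetNorm

variable {E : Type*} [NormedAddCommGroup E]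

theorem hausdorffEDist_ne_top_of_isCompact {A B : Set E} (hA : IsCompact A) (hB : IsCompact B)
    (hAn : A.Nonempty) (hBn : B.Nonempty) : hausdorffEDist A B ≠ ∞ :=
  hausdorffEDist_ne_top_of_nonempty_of_bounded hAn hBn hA.isBounded hB.isBounded

theorem norm_le_setNorm {A : Set E} (hA : IsCompact A) {a : E} (ha : a ∈ A) :
    ‖a‖ ≤ setNorm A := by
  have := infDist_le_hausdorffDist_of_mem ha (hausdorffEDist_ne_top_of_isCompact hA
    (isCompact_singleton (x := (0 : E))) ⟨a, ha⟩ (singleton_nonempty _))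
  simpa [setNorm] using this

theorem setNorm_le {A : Set E} (hA : A.Nonempty) {r : ℝ} (h : ∀ a ∈ A, ‖a‖ ≤ r) :
    setNorm A ≤ r := by
  obtain ⟨a₀, ha₀⟩ := hA
  refine hausdorffDist_le_of_mem_dist ((norm_nonneg _).trans (h a₀ ha₀))
    (fun a ha => ⟨0, rfl, by simpa using h a ha⟩) fun x hx => ⟨a₀, ha₀, ?_⟩
  rw [mem_singleton_iff.1 hx]
  simpa using h a₀ ha₀

theorem hausdorffDist_le_setNorm_add {A B : Set E} (hA : IsCompact A) (hAn : A.Nonempty) :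
    hausdorffDist A B ≤ setNorm A + setNorm B := by
  rw [setNorm, setNorm, hausdorffDist_comm (s := B)]
  exact hausdorffDist_triangle (hausdorffEDist_ne_top_of_isCompact hA isCompact_singleton hAn
    (singleton_nonempty 0))

end SetNorm

theorem MeasureTheory.MemLp.condExp_two {Ω : Type*} {m m₀ : MeasurableSpace Ω}
    {μ : Measure[m₀] Ω} [IsFiniteMeasure μ] (hm : m ≤ m₀) {f : Ω → ℝ} (hf : MemLp f 2 μ) :
    MemLp (μ[f | m]) 2 μ :=
  (Lp.memLp (condExpL2 ℝ ℝ hm hf.toLp : Lp ℝ 2 μ)).ae_eq (hf.condExpL2_ae_eq_condExp hm)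

/-! ### Conditional expectations of selections as a decomposable family -/

section CondExpSelections

variable {Ω E : Type*} [NormedAddCommGroup E] [NormedSpace ℝ E]
  {m m₀ : MeasurableSpace Ω} {μ : Measure[m₀] Ω} {X : Ω → Set E}

/-- The `m`-measurable versions of the conditional expectations of the integrable selections
of `X`. -/
def condExpSelections (m : MeasurableSpace Ω) {m₀ : MeasurableSpace Ω} (μ : Measure[m₀] Ω)
    (X : Ω → Set E) : Set (Ω → E) :=
  {g | StronglyMeasurable[m] g ∧
    ∃ φ, Integrable φ μ ∧ (∀ᵐ ω ∂μ, φ ω ∈ X ω) ∧ g =ᵐ[μ] μ[φ | m]}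

theorem condExp_mem_condExpSelections {φ : Ω → E} (hφ : Integrable φ μ)
    (hφX : ∀ᵐ ω ∂μ, φ ω ∈ X ω) : μ[φ | m] ∈ condExpSelections m μ X :=
  ⟨stronglyMeasurable_condExp, φ, hφ, hφX, .rfl⟩

theorem condExpSelections_congr_ae {g g' : Ω → E} (hg : g ∈ condExpSelections m μ X)
    (hg' : StronglyMeasurable[m] g') (h : g' =ᵐ[μ] g) : g' ∈ condExpSelections m μ X :=
  ⟨hg', hg.2.imp fun _ hφ => ⟨hφ.1, hφ.2.1, h.trans hφ.2.2⟩⟩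

theorem MemLpConvexCompact.integrable_selection [IsFiniteMeasure μ]
    (hX : MemLpConvexCompact m₀ 2 μ X) {φ : Ω → E} (hφ : AEStronglyMeasurable φ μ)
    (hφX : ∀ᵐ ω ∂μ, φ ω ∈ X ω) : Integrable φ μ := by
  obtain ⟨ℓ, -, hℓ, -, hb⟩ := hX.bounded
  refine (hℓ.integrable one_le_two).mono' hφ ?_
  filter_upwards [hφX, hb] with ω h1 h2
  exact (norm_le_setNorm (hX.isCompact ω) h1).trans h2

theorem MemLpConvexCompact.exists_integrable_selection [MeasurableSpace E] [BorelSpace E]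
    [SecondCountableTopology E] [IsFiniteMeasure μ]
    (hX : MemLpConvexCompact m₀ 2 μ X) :
    ∃ φ : Ω → E, Integrable φ μ ∧ ∀ ω, φ ω ∈ X ω := by
  obtain ⟨φ, hφ, hφX⟩ := exists_measurable_selection hX.measurable hX.isCompact hX.nonempty
  exact ⟨φ, hX.integrable_selection hφ.aestronglyMeasurable (.of_forall hφX), hφX⟩

variable [CompleteSpace E]

theorem MemLpConvexCompact.exists_norm_le [IsFiniteMeasure μ] (hm : m ≤ m₀)
    (hX : MemLpConvexCompact m₀ 2 μ X) :
    ∃ ℓ : Ω → ℝ, StronglyMeasurable[m] ℓ ∧ MemLp ℓ 2 μ ∧ (∀ ω, 0 ≤ ℓ ω) ∧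
      ∀ g ∈ condExpSelections m μ X, ∀ᵐ ω ∂μ, ‖g ω‖ ≤ ℓ ω := by
  obtain ⟨ℓ, -, hℓ, -, hb⟩ := hX.bounded
  -- The norm makes the bound nonnegative everywhere, not just almost everywhere.
  refine ⟨fun ω => ‖(μ[ℓ | m]) ω‖, stronglyMeasurable_condExp.norm, (hℓ.condExp_two hm).norm,
    fun ω => norm_nonneg _, ?_⟩
  rintro g ⟨-, φ, hφ, hφX, hg⟩
  have hle : (‖φ ·‖) ≤ᵐ[μ] ℓ := by
    filter_upwards [hφX, hb] with ω h1 h2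
    exact (norm_le_setNorm (hX.isCompact ω) h1).trans h2
  filter_upwards [hg, norm_condExp_le (m := m) φ,
    condExp_mono (m := m) hφ.norm (hℓ.integrable one_le_two) hle] with ω h1 h2 h3
  rw [h1]
  exact (h2.trans h3).trans (le_abs_self _)

theorem MemLpConvexCompact.convex_condExpSelections (hX : MemLpConvexCompact m₀ 2 μ X) :
    Convex ℝ (condExpSelections m μ X) := by
  rintro f ⟨hf, φ, hφ, hφX, hfφ⟩ g ⟨hg, ψ, hψ, hψX, hgψ⟩ a b ha hb hab
  refine ⟨(hf.const_smul a).add (hg.const_smul b), a • φ + b • ψ, (hφ.smul a).add (hψ.smul b),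
    ?_, ?_⟩
  · filter_upwards [hφX, hψX] with ω h1 h2
    exact hX.convex ω h1 h2 ha hb hab
  · filter_upwards [hfφ, hgψ, condExp_smul (μ := μ) a φ m, condExp_smul (μ := μ) b ψ m,
      condExp_add (hφ.smul a) (hψ.smul b) m] with ω h1 h2 h3 h4 h5
    rw [h5, Pi.add_apply, Pi.add_apply, h3, h4]
    simp [h1, h2]

variable [MeasurableSpace E] [BorelSpace E] [SecondCountableTopology E]

/-- Conditional expectation commutes with indicators of `m`-measurable sets, so pasting conditional
expectations amounts to pasting the selections. -/
theorem MemLpConvexCompact.isDecomposable_condExpSelections [IsFiniteMeasure μ] (hm : m ≤ m₀)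
    (hX : MemLpConvexCompact m₀ 2 μ X) : IsDecomposable m μ (condExpSelections m μ X) where
  nonempty := by
    obtain ⟨φ, hφ, hφX⟩ := hX.exists_integrable_selection
    exact ⟨_, condExp_mem_condExpSelections hφ (.of_forall hφX)⟩
  stronglyMeasurable f hf := hf.1
  integrable := by
    rintro f ⟨-, φ, hφ, -, h⟩
    exact integrable_condExp.congr h.symm
  paste := by
    rintro f ⟨hf, φ, hφ, hφX, hfφ⟩ g ⟨hg, ψ, hψ, hψX, hgψ⟩ A hA
    refine ⟨(hf.indicator hA).add (hg.indicator hA.compl), A.indicator φ + Aᶜ.indicator ψ,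
      (hφ.indicator (hm _ hA)).add (hψ.indicator (hm _ hA.compl)), ?_, ?_⟩
    · filter_upwards [hφX, hψX] with ω h1 h2
      by_cases hω : ω ∈ A <;> simpa [hω]
    · filter_upwards [hfφ, hgψ, condExp_indicator (m := m) hφ hA,
        condExp_indicator (m := m) hψ hA.compl, condExp_add (hφ.indicator (hm _ hA))
          (hψ.indicator (hm _ hA.compl)) m] with ω h1 h2 h3 h4 h5
      rw [h5, Pi.add_apply, Pi.add_apply, h3, h4]
      by_cases hω : ω ∈ A <;> simp [hω, h1, h2]

end CondExpSelections

/-! ### Integrable selections determine a closed-valued map -/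

section Selections

variable {Ω E : Type*} [NormedAddCommGroup E]
  {m m₀ : MeasurableSpace Ω} {μ : Measure[m₀] Ω}

/-- An `L¹`-convergent sequence has an almost everywhere convergent subsequence. -/
theorem isClosed_setOf_ae_mem {Y : Ω → Set E} (hY : ∀ ω, IsClosed (Y ω)) :
    IsClosed {f : Lp E 1 μ | ∀ᵐ ω ∂μ, (f : Ω → E) ω ∈ Y ω} := by
  refine IsSeqClosed.isClosed fun u f hu huf => ?_
  obtain ⟨ns, -, hns⟩ := (tendstoInMeasure_of_tendsto_Lp huf).exists_seq_tendsto_ae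
  filter_upwards [ae_all_iff.2 hu, hns] with ω h1 h2
  exact (hY ω).mem_of_tendsto h2 (.of_forall fun n => h1 _)

theorem isClosed_selectionsL1 [NormedSpace ℝ E] [CompleteSpace E] (hm : m ≤ m₀) {Y : Ω → Set E}
    (hY : ∀ ω, IsClosed (Y ω)) : IsClosed (selectionsL1 m μ Y) :=
  (isClosed_aestronglyMeasurable hm).inter (isClosed_setOf_ae_mem hY)

theorem toL1_mem_selectionsL1 {Y : Ω → Set E} {f : Ω → E} (hf : Integrable f μ)
    (hfm : AEStronglyMeasurable[m] f μ) (hfY : ∀ᵐ ω ∂μ, f ω ∈ Y ω) :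
    hf.toL1 f ∈ selectionsL1 m μ Y := by
  refine ⟨hfm.congr hf.coeFn_toL1.symm, ?_⟩
  filter_upwards [hf.coeFn_toL1, hfY] with ω h1 h2
  rwa [h1]

variable [MeasurableSpace E] [BorelSpace E] [ProperSpace E]

/-- A measurable closed-valued map is contained in another one almost everywhere as soon as its
integrable selections are. -/
theorem ae_subset_of_selectionsL1_subset [IsFiniteMeasure μ] (hm : m ≤ m₀) {Y Z : Ω → Set E}
    (hY : SetValuedMeasurable m Y) (hYc : ∀ ω, IsClosed (Y ω))
    (hZc : ∀ ω, IsClosed (Z ω))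
    (hne : (selectionsL1 m μ Y).Nonempty) (hsub : selectionsL1 m μ Y ⊆ selectionsL1 m μ Z) :
    ∀ᵐ ω ∂μ, Y ω ⊆ Z ω := by
  classical
  obtain ⟨f₀, hf₀m, hf₀⟩ := hne
  -- Where `Y` meets the ball, select a point of it there; elsewhere keep the given integrable
  -- selection. The result is an integrable selection of `Y`, hence of `Z`, so `Z` meets the ball
  -- too.
  have key : ∀ (x : E) (r : ℝ), ∀ᵐ ω ∂μ, (Y ω ∩ closedBall x r).Nonempty →
      (Z ω ∩ closedBall x r).Nonempty := by
    intro x r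
    set A : Set Ω := {ω | (Y ω ∩ closedBall x r).Nonempty} with hA
    have hAm : MeasurableSet[m] A := hY _ isClosed_closedBall
    set g := hf₀m.mk f₀
    have hgm : StronglyMeasurable[m] g := hf₀m.stronglyMeasurable_mk
    have hg : (f₀ : Ω → E) =ᵐ[μ] g := hf₀m.ae_eq_mk
    obtain ⟨s, hs, hsF⟩ := @exists_measurable_selection Ω E m _ _ _ _
      (A.piecewise (fun ω => Y ω ∩ closedBall x r) fun ω => {g ω})
      (@SetValuedMeasurable.ite Ω E m _ _ _
        (@SetValuedMeasurable.inter_isClosed Ω E m _ _ hY _ isClosed_closedBall)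
        (@setValuedMeasurable_singleton Ω E m _ _ _ _ hgm.measurable) _ hAm _)
      (fun ω => by
        by_cases hω : ω ∈ A
        · simpa [hω] using (isCompact_closedBall x r).inter_left (hYc ω)
        · simp [hω])
      (fun ω => by
        by_cases hω : ω ∈ A
        · rwa [piecewise_eq_of_mem _ _ _ hω]
        · simp [hω])
    have hsm : StronglyMeasurable[m] s := hs.stronglyMeasurable
    have hsi : Integrable s μ := by
      refine Integrable.mono' (g := fun ω => ‖f₀ ω‖ + (‖x‖ + |r|))
        ((L1.integrable_coeFn f₀).norm.add (integrable_const _))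
        (hsm.mono hm).aestronglyMeasurable ?_
      filter_upwards [hg] with ω hω
      have h1 := hsF ω
      by_cases hωA : ω ∈ A
      · simp only [hωA, piecewise_eq_of_mem] at h1
        have h2 := mem_closedBall_iff_norm.1 h1.2
        have h3 := norm_le_norm_add_norm_sub' (s ω) x
        have h4 := le_abs_self r
        have h5 := norm_nonneg (f₀ ω)
        linarith
      · simp only [hωA, not_false_eq_true, piecewise_eq_of_notMem, mem_singleton_iff] at h1
        rw [h1, ← hω]
        have := norm_nonneg x
        have := abs_nonneg r
        linarith
    have hsY : ∀ᵐ ω ∂μ, s ω ∈ Y ω := by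
      filter_upwards [hg, hf₀] with ω h1 h2
      have h3 := hsF ω
      by_cases hωA : ω ∈ A
      · simp only [hωA, piecewise_eq_of_mem] at h3
        exact h3.1
      · simp only [hωA, not_false_eq_true, piecewise_eq_of_notMem, mem_singleton_iff] at h3
        rwa [h3, ← h1]
    have hsZ := (hsub (toL1_mem_selectionsL1 hsi hsm.aestronglyMeasurable hsY)).2
    filter_upwards [hsZ, hsi.coeFn_toL1] with ω h1 h2 hωA
    have h3 := hsF ω
    rw [piecewise_eq_of_mem _ _ _ (show ω ∈ A from hωA)] at h3
    exact ⟨s ω, h2 ▸ h1, h3.2⟩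
  have hall : ∀ᵐ ω ∂μ, ∀ i k : ℕ, (Y ω ∩ closedBall (denseSeq E i) (1 / ((k : ℝ) + 1))).Nonempty →
      (Z ω ∩ closedBall (denseSeq E i) (1 / ((k : ℝ) + 1))).Nonempty :=
    ae_all_iff.2 fun i => ae_all_iff.2 fun k => key _ _
  filter_upwards [hall] with ω hω y hy
  rw [← (hZc ω).closure_eq, Metric.mem_closure_iff]
  intro ε hε
  obtain ⟨k, hk⟩ := exists_nat_one_div_lt (K := ℝ) (half_pos hε)
  obtain ⟨i, hi⟩ := (denseRange_denseSeq E).exists_dist_lt y (Nat.one_div_pos_of_nat (α := ℝ)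
    (n := k))
  obtain ⟨z, hz, hzb⟩ := hω i k ⟨y, hy, mem_closedBall.2 hi.le⟩
  refine ⟨z, hz, ?_⟩
  have := dist_triangle_right y z (denseSeq E i)
  have := mem_closedBall.1 hzb
  linarith

end Selections

/-! ### Existence and uniqueness of the set-valued conditional expectation -/

section SetCondExp

variable {Ω E : Type*} [NormedAddCommGroup E] [NormedSpace ℝ E]
  {m m₀ : MeasurableSpace Ω} {μ : Measure[m₀] Ω} {X : Ω → Set E}

theorem IsSetCondExp.ae_mem [CompleteSpace E] {Y : Ω → Set E} (hY : IsSetCondExp m μ X Y) {φ : Ω → E}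
    (hφ : Integrable φ μ) (hφX : ∀ᵐ ω ∂μ, φ ω ∈ X ω) : ∀ᵐ ω ∂μ, (μ[φ | m]) ω ∈ Y ω := by
  have hi : Integrable (μ[φ | m]) μ := integrable_condExp
  have h : hi.toL1 _ ∈ selectionsL1 m μ Y := by
    rw [hY.selections_eq]
    exact subset_closure ⟨hφ.toL1 φ, toL1_mem_selectionsL1 hφ hφ.aestronglyMeasurable hφX,
      hi.coeFn_toL1.trans (condExp_congr_ae hφ.coeFn_toL1.symm)⟩
  filter_upwards [h.2, hi.coeFn_toL1] with ω h1 h2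
  rwa [← h2]

variable [MeasurableSpace E] [BorelSpace E] [ProperSpace E]

theorem IsSetCondExp.ae_eq [IsFiniteMeasure μ] (hm : m ≤ m₀) {Y Z : Ω → Set E}
    (hY : IsSetCondExp m μ X Y) (hZ : IsSetCondExp m μ X Z) : Y =ᵐ[μ] Z := by
  have h : selectionsL1 m μ Y = selectionsL1 m μ Z := hY.selections_eq.trans hZ.selections_eq.symm
  filter_upwards [ae_subset_of_selectionsL1_subset hm hY.measurable hY.isClosed
      hZ.isClosed hY.integrable h.subset,
    ae_subset_of_selectionsL1_subset hm hZ.measurable hZ.isClosed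
      hY.isClosed hZ.integrable h.superset] with ω h1 h2
  exact h1.antisymm h2

theorem MemLpConvexCompact.exists_pointwise_condExp_seq [IsFiniteMeasure μ] (hm : m ≤ m₀)
    (hX : MemLpConvexCompact m₀ 2 μ X) :
    ∃ f : ℕ → Ω → E, (∀ n, f n ∈ condExpSelections m μ X) ∧
      (∀ g ∈ condExpSelections m μ X, ∀ᵐ ω ∂μ, g ω ∈ closure (range fun n => f n ω)) ∧
      MemLpConvexCompact m 2 μ fun ω => closure (range fun n => f n ω) := by
  have hM := hX.isDecomposable_condExpSelections hm
  obtain ⟨f, hf, hfd⟩ := hM.exists_seq hm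
  obtain ⟨ℓ, hℓm, hℓ, hℓ0, hb⟩ := hX.exists_norm_le hm
  set c : ℕ → ℕ → ℚ → Ω → E := fun j k q => (1 - (q : ℝ)) • f j + (q : ℝ) • f k with hc
  have hcM : ∀ j k q, StronglyMeasurable[m] (c j k q) := fun j k q =>
    ((hf j).1.const_smul _).add ((hf k).1.const_smul _)
  -- Compactness and convexity are required at every `ω`. Both follow on `G`, an `m`-measurable set
  -- of full measure cut out by countably many conditions; off `G` the sequence is replaced by zero.
  set G : Set Ω := {ω | ∀ n, ‖f n ω‖ ≤ ℓ ω} ∩ {ω | ∀ (j k : ℕ) (q : ℚ), 0 ≤ q → q ≤ 1 →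
    c j k q ω ∈ closure (range fun n => f n ω)} with hG
  have hGm : MeasurableSet[m] G := by
    refine MeasurableSet.inter ?_ ?_
    · simp only [ofPred_forall]
      exact .iInter fun n => (hf n).1.norm.measurableSet_le hℓm
    · simp only [ofPred_forall]
      exact .iInter fun j => .iInter fun k => .iInter fun q => .iInter fun _ => .iInter fun _ =>
        @measurableSet_mem_closure_range Ω E m _ _ (fun n => (hf n).1) _ (hcM j k q)
  have hGae : ∀ᵐ ω ∂μ, ω ∈ G := by
    have h1 : ∀ᵐ ω ∂μ, ∀ n, ‖f n ω‖ ≤ ℓ ω := ae_all_iff.2 fun n => hb _ (hf n)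
    have h2 : ∀ᵐ ω ∂μ, ∀ (j k : ℕ) (q : ℚ), 0 ≤ q → q ≤ 1 →
        c j k q ω ∈ closure (range fun n => f n ω) := by
      refine ae_all_iff.2 fun j => ae_all_iff.2 fun k => ae_all_iff.2 fun q => ?_
      by_cases hq : 0 ≤ q ∧ q ≤ 1
      · refine (hfd _ (hX.convex_condExpSelections (hf j) (hf k) (sub_nonneg.2 ?_) ?_
          (sub_add_cancel (1 : ℝ) q))).mono fun ω h _ _ => h
        · exact_mod_cast hq.2
        · exact_mod_cast hq.1
      · exact .of_forall fun ω h0 h1 => absurd ⟨h0, h1⟩ hq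
    filter_upwards [h1, h2] with ω h1 h2 using ⟨h1, h2⟩
  have hin : ∀ ω ∈ G, (fun n => G.indicator (f n) ω) = fun n => f n ω := fun ω hω => by
    funext n; simp [hω]
  have hout : ∀ ω ∉ G, (fun n => G.indicator (f n) ω) = fun _ => 0 := fun ω hω => by
    funext n; simp [hω]
  have hfG : ∀ n, StronglyMeasurable[m] (G.indicator (f n)) := fun n => (hf n).1.indicator hGm
  have hle : ∀ ω n, ‖G.indicator (f n) ω‖ ≤ ℓ ω := fun ω n => by
    by_cases hω : ω ∈ G
    · simpa [hω] using hω.1 n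
    · simpa [hω] using hℓ0 ω
  have hsub : ∀ ω, closure (range fun n => G.indicator (f n) ω) ⊆ closedBall 0 (ℓ ω) := fun ω =>
    closure_minimal (by rintro _ ⟨n, rfl⟩; simpa using hle ω n) isClosed_closedBall
  have hcomp : ∀ ω, IsCompact (closure (range fun n => G.indicator (f n) ω)) := fun ω =>
    (isCompact_closedBall (0 : E) (ℓ ω)).of_isClosed_subset isClosed_closure (hsub ω)
  refine ⟨fun n => G.indicator (f n), fun n => ?_, fun g hg => ?_, ?_⟩
  · refine condExpSelections_congr_ae (hf n) (hfG n) ?_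
    filter_upwards [hGae] with ω hω
    simp [hω]
  · filter_upwards [hGae, hfd g hg] with ω h1 h2
    rwa [hin ω h1]
  · refine ⟨@setValuedMeasurable_closure_range Ω E m _ _ _ _ (fun n => (hfG n).measurable) hcomp,
      fun ω => (range_nonempty _).closure, hcomp, fun ω => ?_,
      ℓ, hℓm, hℓ, hℓ0, .of_forall fun ω => setNorm_le (range_nonempty _).closure fun a ha => ?_⟩
    · by_cases hω : ω ∈ G
      · rw [hin ω hω]
        exact convex_closure_range_of_rat hω.2
      · rw [hout ω hω]
        simp
    · simpa using hsub ω ha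

/-- The conditional expectation of a square-integrably bounded set-valued map exists and is the
pointwise closure of a sequence of conditional expectations of selections. -/
theorem MemLpConvexCompact.exists_isSetCondExp_closure_range [IsProbabilityMeasure μ] (hm : m ≤ m₀)
    (hX : MemLpConvexCompact m₀ 2 μ X) :
    ∃ f : ℕ → Ω → E, (∀ n, f n ∈ condExpSelections m μ X) ∧
      MemLpConvexCompact m 2 μ (fun ω => closure (range fun n => f n ω)) ∧
      IsSetCondExp m μ X fun ω => closure (range fun n => f n ω) := by
  have hM := hX.isDecomposable_condExpSelections hm
  obtain ⟨f, hf, hfd, hY⟩ := hX.exists_pointwise_condExp_seq hm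
  refine ⟨f, hf, hY, hY.measurable, hY.nonempty, fun ω => isClosed_closure, ?_, ?_⟩
  · exact ⟨_, toL1_mem_selectionsL1 (hM.integrable _ (hf 0)) (hf 0).1.aestronglyMeasurable
      (hfd _ (hf 0))⟩
  refine Subset.antisymm (fun g hg => ?_)
    (closure_minimal ?_ (isClosed_selectionsL1 hm fun ω => isClosed_closure))
  -- A selection of the closure is approximated in `L¹` by pasting the `f n`, and decomposability
  -- keeps the pasted functions in the family.
  · rw [Metric.mem_closure_iff]
    intro ε hε
    obtain ⟨hgm, hgY⟩ := hg
    have hgi := (L1.integrable_coeFn g).congr hgm.ae_eq_mk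
    obtain ⟨u, ⟨hum, φ, hφ, hφX, huφ⟩, hu⟩ := hM.exists_integral_norm_sub_lt hm hf
      hgm.stronglyMeasurable_mk hgi (by
        filter_upwards [hgY, hgm.ae_eq_mk] with ω h1 h2
        rwa [← h2]) hε
    have hui : Integrable u μ := integrable_condExp.congr huφ.symm
    refine ⟨hui.toL1 u, ⟨hφ.toL1 φ, toL1_mem_selectionsL1 hφ hφ.aestronglyMeasurable hφX,
      hui.coeFn_toL1.trans (huφ.trans (condExp_congr_ae hφ.coeFn_toL1.symm))⟩, ?_⟩
    rw [dist_eq_norm, L1.norm_eq_integral_norm]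
    refine (integral_congr_ae ?_).trans_lt hu
    filter_upwards [Lp.coeFn_sub g (hui.toL1 u), hgm.ae_eq_mk, hui.coeFn_toL1] with ω h1 h2 h3
    rw [h1, Pi.sub_apply, h2, h3]
  · rintro g ⟨φ, ⟨-, hφX⟩, hg⟩
    refine ⟨⟨_, stronglyMeasurable_condExp, hg⟩, ?_⟩
    filter_upwards [hg, hfd _ (condExp_mem_condExpSelections (L1.integrable_coeFn φ) hφX)]
      with ω h1 h2
    rwa [h1]

end SetCondExp

/-- This is nonnegativity of the conditional variance. -/
theorem sq_condExp_le {Ω : Type*} {m m₀ : MeasurableSpace Ω} {μ : Measure[m₀] Ω}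
    [IsFiniteMeasure μ] (hm : m ≤ m₀) {f : Ω → ℝ} (hf : MemLp f 2 μ) :
    ∀ᵐ ω ∂μ, (μ[f | m]) ω ^ 2 ≤ (μ[fun ω => f ω ^ 2 | m]) ω := by
  have h0 : 0 ≤ᵐ[μ] ProbabilityTheory.condVar m f μ :=
    condExp_nonneg (.of_forall fun ω => sq_nonneg _)
  filter_upwards [h0, ProbabilityTheory.condVar_ae_eq_condExp_sq_sub_sq_condExp hm hf]
    with ω h1 h2
  rw [h2] at h1
  exact sub_nonneg.1 h1

theorem infDist_le_of_mem_closure_range {E : Type*} [NormedAddCommGroup E] {v : ℕ → E}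
    {B : Set E} {r : ℝ}
    (h : ∀ n, infDist (v n) B ≤ r) {x : E} (hx : x ∈ closure (range v)) : infDist x B ≤ r :=
  closure_minimal (s := range v) (t := {x | infDist x B ≤ r}) (by rintro _ ⟨n, rfl⟩; exact h n)
    (isClosed_le (continuous_infDist_pt B) continuous_const) hx

theorem selectionsL1_zero {Ω E : Type*} [NormedAddCommGroup E] {m m₀ : MeasurableSpace Ω}
    {μ : Measure[m₀] Ω} :
    selectionsL1 m μ (fun _ : Ω => ({0} : Set E)) = {0} := by
  ext f
  simp only [selectionsL1, mem_ofPred_eq, mem_singleton_iff]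
  refine ⟨fun h => Lp.eq_zero_iff_ae_eq_zero.2 h.2, ?_⟩
  rintro rfl
  have h : ((0 : Lp E 1 μ) : Ω → E) =ᵐ[μ] 0 := Lp.coeFn_zero E 1 μ
  exact ⟨⟨0, stronglyMeasurable_zero, h⟩, h⟩

/-! ### Contraction estimates for the Hausdorff distance -/

section HausdorffDist

variable {Ω E : Type*} [NormedAddCommGroup E] [NormedSpace ℝ E]
  {m m₀ : MeasurableSpace Ω} {μ : Measure[m₀] Ω} {X₁ X₂ : Ω → Set E}

theorem MemLpConvexCompact.mono (hm : m ≤ m₀) (hX : MemLpConvexCompact m 2 μ X₁) :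
    MemLpConvexCompact m₀ 2 μ X₁ where
  measurable B hB := hm _ (hX.measurable B hB)
  nonempty := hX.nonempty
  isCompact := hX.isCompact
  convex := hX.convex
  bounded := hX.bounded.imp fun _ h => ⟨h.1.mono hm, h.2⟩

theorem memLpConvexCompact_zero [IsFiniteMeasure μ] :
    MemLpConvexCompact m 2 μ fun _ : Ω => ({0} : Set E) where
  measurable B _ := by simp
  nonempty _ := singleton_nonempty 0
  isCompact _ := isCompact_singleton
  convex _ := convex_singleton 0
  bounded := ⟨0, stronglyMeasurable_zero, MemLp.zero, fun _ => le_rfl,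
    .of_forall fun ω => by simp [setNorm]⟩

theorem isSetCondExp_zero [CompleteSpace E] :
    IsSetCondExp m μ (fun _ : Ω => ({0} : Set E)) fun _ => {0} where
  measurable B _ := by simp
  nonempty _ := singleton_nonempty 0
  isClosed _ := isClosed_singleton
  integrable := by rw [selectionsL1_zero]; exact singleton_nonempty 0
  selections_eq := by
    rw [selectionsL1_zero, selectionsL1_zero]
    have h0 : μ[((0 : Lp E 1 μ) : Ω → E) | m] =ᵐ[μ] 0 :=
      (condExp_congr_ae (Lp.coeFn_zero E 1 μ)).trans (by rw [condExp_zero])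
    have : {g : Lp E 1 μ | ∃ f ∈ ({0} : Set (Lp E 1 μ)), (g : Ω → E) =ᵐ[μ] μ[(f : Ω → E) | m]} =
        {0} := by
      ext g
      simp only [mem_singleton_iff, exists_eq_left, mem_ofPred_eq]
      rw [Lp.eq_zero_iff_ae_eq_zero]
      exact ⟨fun h => h.trans h0, fun h => h.trans h0.symm⟩
    rw [this, closure_singleton]

theorem MemLpConvexCompact.hausdorffEDist_ne_top (hX₁ : MemLpConvexCompact m₀ 2 μ X₁)
    (hX₂ : MemLpConvexCompact m₀ 2 μ X₂) (ω : Ω) : hausdorffEDist (X₁ ω) (X₂ ω) ≠ ∞ :=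
  hausdorffEDist_ne_top_of_isCompact (hX₁.isCompact ω) (hX₂.isCompact ω) (hX₁.nonempty ω)
    (hX₂.nonempty ω)

theorem MemLpConvexCompact.memLp_hausdorffDist [SecondCountableTopology E]
    (hX₁ : MemLpConvexCompact m₀ 2 μ X₁) (hX₂ : MemLpConvexCompact m₀ 2 μ X₂) :
    MemLp (fun ω => hausdorffDist (X₁ ω) (X₂ ω)) 2 μ := by
  obtain ⟨ℓ₁, -, hℓ₁, -, hb₁⟩ := hX₁.bounded
  obtain ⟨ℓ₂, -, hℓ₂, -, hb₂⟩ := hX₂.bounded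
  refine (hℓ₁.add hℓ₂).mono' (hX₁.measurable.measurable_hausdorffDist hX₂.measurable
    hX₁.isCompact hX₂.isCompact hX₁.nonempty hX₂.nonempty).aestronglyMeasurable ?_
  filter_upwards [hb₁, hb₂] with ω h1 h2
  rw [Real.norm_of_nonneg hausdorffDist_nonneg]
  exact (hausdorffDist_le_setNorm_add (hX₁.isCompact ω) (hX₁.nonempty ω)).trans (add_le_add h1 h2)

variable [MeasurableSpace E] [BorelSpace E] [ProperSpace E]

/-- Every integrable selection `φ` of `X₁` has an integrable selection of `X₂` within distance
`h(X₁, X₂)`. -/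
theorem MemLpConvexCompact.exists_selection_norm_sub_le [IsFiniteMeasure μ]
    (hX₁ : MemLpConvexCompact m₀ 2 μ X₁) (hX₂ : MemLpConvexCompact m₀ 2 μ X₂) {φ : Ω → E}
    (hφ : AEStronglyMeasurable φ μ) (hφX : ∀ᵐ ω ∂μ, φ ω ∈ X₁ ω) :
    ∃ ψ : Ω → E, Integrable ψ μ ∧ (∀ ω, ψ ω ∈ X₂ ω) ∧
      ∀ᵐ ω ∂μ, ‖φ ω - ψ ω‖ ≤ hausdorffDist (X₁ ω) (X₂ ω) := by
  obtain ⟨ψ, hψm, hψ⟩ := exists_measurable_selection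
    (hX₂.measurable.nearestPoints hX₂.isCompact hX₂.nonempty hφ.stronglyMeasurable_mk.measurable)
    (fun ω => nearestPoints_isCompact (hX₂.isCompact ω) _)
    (fun ω => nearestPoints_nonempty (hX₂.isCompact ω) (hX₂.nonempty ω) _)
  refine ⟨ψ, hX₂.integrable_selection hψm.aestronglyMeasurable (.of_forall fun ω => (hψ ω).1),
    fun ω => (hψ ω).1, ?_⟩
  filter_upwards [hφX, hφ.ae_eq_mk] with ω h1 h2
  have h3 := congrArg ENNReal.toReal (edist_eq_of_mem_nearestPoints (hψ ω))
  rw [← h2, ← dist_edist, dist_eq_norm] at h3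
  rw [h3]
  exact infDist_le_hausdorffDist_of_mem h1 (hX₁.hausdorffEDist_ne_top hX₂ ω)

theorem MemLpConvexCompact.infDist_le_condExp [IsFiniteMeasure μ]
    (hX₁ : MemLpConvexCompact m₀ 2 μ X₁) (hX₂ : MemLpConvexCompact m₀ 2 μ X₂)
    {Y₂ : Ω → Set E} (hY₂ : IsSetCondExp m μ X₂ Y₂) {g : Ω → E}
    (hg : g ∈ condExpSelections m μ X₁) :
    ∀ᵐ ω ∂μ, infDist (g ω) (Y₂ ω) ≤
      (μ[fun ω => hausdorffDist (X₁ ω) (X₂ ω) | m]) ω := by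
  obtain ⟨-, φ, hφ, hφX, hgφ⟩ := hg
  obtain ⟨ψ, hψ, hψX, hle⟩ := hX₁.exists_selection_norm_sub_le hX₂ hφ.aestronglyMeasurable hφX
  filter_upwards [hgφ, hY₂.ae_mem hψ (.of_forall hψX), condExp_sub hφ hψ m,
    norm_condExp_le (μ := μ) (m := m) (φ - ψ),
    condExp_mono (m := m) (hφ.sub hψ).norm
      ((hX₁.memLp_hausdorffDist hX₂).integrable one_le_two) hle] with ω h1 h2 h3 h4 h5
  refine (infDist_le_dist_of_mem h2).trans ?_
  rw [dist_eq_norm, h1, ← Pi.sub_apply, ← h3]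
  exact h4.trans h5

/-- The set-valued conditional expectation is a contraction for the Hausdorff distance. -/
theorem MemLpConvexCompact.hausdorffDist_condExp_le [IsProbabilityMeasure μ] (hm : m ≤ m₀)
    (hX₁ : MemLpConvexCompact m₀ 2 μ X₁) (hX₂ : MemLpConvexCompact m₀ 2 μ X₂)
    {Y₁ Y₂ : Ω → Set E} (hY₁ : IsSetCondExp m μ X₁ Y₁) (hY₂ : IsSetCondExp m μ X₂ Y₂) :
    ∀ᵐ ω ∂μ, hausdorffDist (Y₁ ω) (Y₂ ω) ≤
      (μ[fun ω => hausdorffDist (X₁ ω) (X₂ ω) | m]) ω := by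
  obtain ⟨f, hf, -, hfY⟩ := hX₁.exists_isSetCondExp_closure_range hm
  obtain ⟨g, hg, -, hgY⟩ := hX₂.exists_isSetCondExp_closure_range hm
  have h0 : 0 ≤ᵐ[μ] μ[fun ω => hausdorffDist (X₁ ω) (X₂ ω) | m] :=
    condExp_nonneg (.of_forall fun ω => hausdorffDist_nonneg)
  have h1 : ∀ᵐ ω ∂μ, ∀ n, infDist (f n ω) (Y₂ ω) ≤
      (μ[fun ω => hausdorffDist (X₁ ω) (X₂ ω) | m]) ω :=
    ae_all_iff.2 fun n => hX₁.infDist_le_condExp hX₂ hY₂ (hf n)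
  have h2 : ∀ᵐ ω ∂μ, ∀ n, infDist (g n ω) (Y₁ ω) ≤
      (μ[fun ω => hausdorffDist (X₂ ω) (X₁ ω) | m]) ω :=
    ae_all_iff.2 fun n => hX₂.infDist_le_condExp hX₁ hY₁ (hg n)
  simp only [hausdorffDist_comm (s := X₂ _)] at h2
  filter_upwards [h0, h1, h2, hY₁.ae_eq hm hfY, hY₂.ae_eq hm hgY] with ω h0 h1 h2 h3 h4
  refine hausdorffDist_le_of_infDist h0 (fun x hx => ?_) fun x hx => ?_
  · exact infDist_le_of_mem_closure_range h1 (h3 ▸ hx)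
  · exact infDist_le_of_mem_closure_range h2 (h4 ▸ hx)

/-- Arbitrary versions are only assumed closed-valued, so integrability is transferred from the
compact-valued versions, to which they are almost everywhere equal. -/
theorem MemLpConvexCompact.integrable_hausdorffDist_sq_condExp [IsProbabilityMeasure μ]
    (hm : m ≤ m₀) (hX₁ : MemLpConvexCompact m₀ 2 μ X₁) (hX₂ : MemLpConvexCompact m₀ 2 μ X₂)
    {Y₁ Y₂ : Ω → Set E} (hY₁ : IsSetCondExp m μ X₁ Y₁) (hY₂ : IsSetCondExp m μ X₂ Y₂) :
    Integrable (fun ω => hausdorffDist (Y₁ ω) (Y₂ ω) ^ 2) μ := by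
  obtain ⟨f, -, hfm, hfY⟩ := hX₁.exists_isSetCondExp_closure_range hm
  obtain ⟨g, -, hgm, hgY⟩ := hX₂.exists_isSetCondExp_closure_range hm
  refine ((hfm.mono hm).memLp_hausdorffDist (hgm.mono hm)).integrable_sq.congr ?_
  filter_upwards [hY₁.ae_eq hm hfY, hY₂.ae_eq hm hgY] with ω h1 h2
  rw [h1, h2]

theorem MemLpConvexCompact.hausdorffDist_sq_condExp_le [IsProbabilityMeasure μ] (hm : m ≤ m₀)
    (hX₁ : MemLpConvexCompact m₀ 2 μ X₁) (hX₂ : MemLpConvexCompact m₀ 2 μ X₂)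
    {Y₁ Y₂ : Ω → Set E} (hY₁ : IsSetCondExp m μ X₁ Y₁) (hY₂ : IsSetCondExp m μ X₂ Y₂) :
    ∀ᵐ ω ∂μ, hausdorffDist (Y₁ ω) (Y₂ ω) ^ 2 ≤
      (μ[fun ω => hausdorffDist (X₁ ω) (X₂ ω) ^ 2 | m]) ω := by
  filter_upwards [hX₁.hausdorffDist_condExp_le hm hX₂ hY₁ hY₂,
    sq_condExp_le hm (hX₁.memLp_hausdorffDist hX₂)] with ω h1 h2
  exact (pow_le_pow_left₀ hausdorffDist_nonneg h1 2).trans h2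

theorem MemLpConvexCompact.setLpDist_condExp_le [IsProbabilityMeasure μ] (hm : m ≤ m₀)
    (hX₁ : MemLpConvexCompact m₀ 2 μ X₁) (hX₂ : MemLpConvexCompact m₀ 2 μ X₂)
    {Y₁ Y₂ : Ω → Set E} (hY₁ : IsSetCondExp m μ X₁ Y₁) (hY₂ : IsSetCondExp m μ X₂ Y₂) :
    setLpDist 2 μ Y₁ Y₂ ≤ setLpDist 2 μ X₁ X₂ := by
  simp only [setLpDist, Real.rpow_two]
  refine Real.rpow_le_rpow (integral_nonneg fun ω => sq_nonneg _) ?_ (by norm_num)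
  rw [← integral_condExp hm (f := fun ω => hausdorffDist (X₁ ω) (X₂ ω) ^ 2)]
  exact integral_mono_ae (hX₁.integrable_hausdorffDist_sq_condExp hm hX₂ hY₁ hY₂)
    integrable_condExp (hX₁.hausdorffDist_sq_condExp_le hm hX₂ hY₁ hY₂)

theorem MemLpConvexCompact.exists_unique_isSetCondExp [IsProbabilityMeasure μ] (hm : m ≤ m₀)
    (hX₁ : MemLpConvexCompact m₀ 2 μ X₁) :
    ∃ Y, MemLpConvexCompact m 2 μ Y ∧ IsSetCondExp m μ X₁ Y ∧
      ∀ Y', IsSetCondExp m μ X₁ Y' → Y' =ᵐ[μ] Y := by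
  obtain ⟨f, -, hfm, hfY⟩ := hX₁.exists_isSetCondExp_closure_range hm
  exact ⟨_, hfm, hfY, fun Y' hY' => hY'.ae_eq hm hfY⟩

end HausdorffDist

end

theorem lemma4p1 {Ω : Type*} {m₀ : MeasurableSpace Ω} (μ : Measure[m₀] Ω) [IsProbabilityMeasure μ]
    (d : ℕ) (m : MeasurableSpace Ω) (hm : m ≤ m₀)
    (X₁ X₂ : Ω → Set (EuclideanSpace ℝ (Fin d)))
    (hX₁ : MemLpConvexCompact m₀ 2 μ X₁) (hX₂ : MemLpConvexCompact m₀ 2 μ X₂) :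
    -- the conditional expectations exist, are square-integrably bounded with compact convex
    -- values, and are unique up to null sets
    (∃ Y, MemLpConvexCompact m 2 μ Y ∧ IsSetCondExp m μ X₁ Y ∧
      ∀ Y', IsSetCondExp m μ X₁ Y' → Y' =ᵐ[μ] Y) ∧
    (∃ Y, MemLpConvexCompact m 2 μ Y ∧ IsSetCondExp m μ X₂ Y ∧
      ∀ Y', IsSetCondExp m μ X₂ Y' → Y' =ᵐ[μ] Y) ∧
    -- the random variables whose (conditional) expectations occur below are integrable
    Integrable (fun ω => Metric.hausdorffDist (X₁ ω) (X₂ ω) ^ 2) μ ∧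
    Integrable (fun ω => setNorm (X₁ ω) ^ 2) μ ∧
    -- the inequalities, for all versions of the conditional expectations
    ∀ Y₁ Y₂ : Ω → Set (EuclideanSpace ℝ (Fin d)),
      IsSetCondExp m μ X₁ Y₁ → IsSetCondExp m μ X₂ Y₂ →
      Integrable (fun ω => Metric.hausdorffDist (Y₁ ω) (Y₂ ω) ^ 2) μ ∧
      (∀ᵐ ω ∂μ, Metric.hausdorffDist (Y₁ ω) (Y₂ ω) ^ 2 ≤
        (μ[fun ω' => Metric.hausdorffDist (X₁ ω') (X₂ ω') ^ 2 | m]) ω) ∧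
      setLpDist 2 μ Y₁ Y₂ ≤ setLpDist 2 μ X₁ X₂ ∧
      (∀ᵐ ω ∂μ, setNorm (Y₁ ω) ^ 2 ≤ (μ[fun ω' => setNorm (X₁ ω') ^ 2 | m]) ω) := by
  -- As `setNorm` is by definition the distance to `{0}`, the statements on norms are those on
  -- distances with `{0}` as second map, which is its own conditional expectation.
  exact ⟨hX₁.exists_unique_isSetCondExp hm, hX₂.exists_unique_isSetCondExp hm,
    (hX₁.memLp_hausdorffDist hX₂).integrable_sq,
    (hX₁.memLp_hausdorffDist memLpConvexCompact_zero).integrable_sq, fun Y₁ Y₂ hY₁ hY₂ =>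
      ⟨hX₁.integrable_hausdorffDist_sq_condExp hm hX₂ hY₁ hY₂,
        hX₁.hausdorffDist_sq_condExp_le hm hX₂ hY₁ hY₂,
        hX₁.setLpDist_condExp_le hm hX₂ hY₁ hY₂,
        hX₁.hausdorffDist_sq_condExp_le hm memLpConvexCompact_zero hY₁ isSetCondExp_zero⟩⟩
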